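/- Let $S_n$ be the set of permutations of $\{0,1,\dots,n-1\}$. The Hamming distance of $\mathbf a,\mathbf b\in S_n$ is the number of $i$ with $\mathbf a(i)\ne\mathbf b(i)$. Let $P(n,d)$ be the maximum size of a subset $C\subseteq S_n$ in which any two distinct members have Hamming distance at least $d$. Let $D_k$ be the number of derangements (permutations without fixed points) of $k$ points, with $D_0=1$, and for real $x$ let $\lceil x\rceil^{+}$ be the smallest nonnegative integer $m\ge x$. For positive integers $d\le n$ put $$V(n,d-1)=\sum_{i=0}^{d-1}\binom{n}{i}D_i,\qquad E(n,d-1)=\frac16\sum_{i=2}^{d-1}\sum_{j=2}^{d-1}\binom{n}{i}D_i\,L_{i,j},$$ where $$L_{i,j}=\sum_{k=\lceil (i+j-d+1)/2\rceil^{+}}^{\min(i,j)}\ \sum_{l=0}^{\min\{d+2k-i-j-1,\;k\}}\binom{i}{k}\binom{n-i}{j-k}\binom{k}{l}\,(l+j-k)!.$$ Then for all positive integers $d\le n$, $$P(n,d)\ \ge\ \frac{n!}{10\,V(n,d-1)}\left(\log_2 V(n,d-1)-\tfrac12\log_2 E(n,d-1)\right),$$ where $\log_2 0$ is read as $0$.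 (This convention matters only for $d\le 2$, where $V(n,d-1)=1$ and $E(n,d-1)=0$.) -/

import Mathlib

namespace PermArray

/-- The Hamming distance of two permutations of `{0, …, n-1}`: the number of positions at which
they differ as `n`-tuples. -/
def permDist {n : ℕ} (a b : Equiv.Perm (Fin n)) : ℕ :=
  hammingDist (fun i => a i) (fun i => b i)

/-- `C` is an `(n, d)` permutation array: any two distinct members of `C` are at Hamming distance
at least `d`. -/
def IsPA {n : ℕ} (d : ℕ) (C : Finset (Equiv.Perm (Fin n))) : Prop :=
  ∀ a ∈ C, ∀ b ∈ C, a ≠ b → d ≤ permDist a b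

open Classical in
/-- `P n d` is the maximum size of an `(n, d)` permutation array. -/
noncomputable def P (n d : ℕ) : ℕ :=
  (Finset.univ.filter fun C : Finset (Equiv.Perm (Fin n)) => IsPA d C).sup Finset.card

/-- `V n r = ∑_{i=0}^{r} C(n,i) D_i`, where `D_i` is the number of derangements of order `i`. -/
def V (n r : ℕ) : ℕ :=
  ∑ i ∈ Finset.Icc 0 r, n.choose i * numDerangements i

/-- The quantity `L_{i,j}` belonging to `n` and `d`. Here `⌈x⌉₊` is the smallest nonnegative
integer `m ≥ x`. For `k` in the range of the outer sum `d + 2k - i - j - 1 ≥ 0` as an integer,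
so the natural-number subtraction below is the usual one; and `k ≤ j`. -/
def L (n d i j : ℕ) : ℕ :=
  ∑ k ∈ Finset.Icc ⌈((i : ℚ) + j - d + 1) / 2⌉₊ (min i j),
    ∑ l ∈ Finset.Icc 0 (min (d + 2 * k - i - j - 1) k),
      i.choose k * (n - i).choose (j - k) * k.choose l * (l + j - k).factorial

/-- `E n r`, for `r = d - 1`, is `(1/6) ∑_{i=2}^{d-1} ∑_{j=2}^{d-1} C(n,i) D_i L_{i,j}`,
with the `L_{i,j}` belonging to `n` and `d = r + 1`. -/
noncomputable def E (n r : ℕ) : ℝ :=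
  (1 / 6 : ℝ) * ∑ i ∈ Finset.Icc 2 r, ∑ j ∈ Finset.Icc 2 r,
    (n.choose i : ℝ) * (numDerangements i : ℝ) * (L n (r + 1) i j : ℝ)

end PermArray

/-! Permutation arrays are the independent sets of `closeGraph`, whose degrees are at most V - 1 and
whose neighbourhoods each span at most 6E ordered adjacent pairs. Sparse neighbourhoods improve the
greedy bound n!/V by a logarithmic factor, and the hard-core model shows this.

Weight each independent set S by t^|S|. Fix a vertex v and condition on the part of S outside its
closed neighbourhood. The neighbours of v not blocked by that part form a sparse set Y. If Y is
large, S has at least T elements in Y on average. If Y is small, its partition function is small, so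
v itself is in S with a fair probability. Hence a·[v ∈ S] + |S ∩ N(v)| has mean at least T for a
suitable a (`local_occupancy`). Summing over v counts each element of S with weight at most a + Δ,
so some S satisfies (a + Δ)|S| ≥ n!·T (`exists_indep_of_sparse_neighborhoods`).

With x = log₂ V - ½ log₂ E, the choices a = V, T = x/5 and t = 1/(3√E) give the theorem when x > 10.
For x ≤ 10 the greedy bound is enough. The edge count uses `permDist_eq` and `card_overlap_le`. -/

namespace SimpleGraph

/-! ### The hard-core model on a finite vertex set. -/

section HardCore

variable {α : Type*} (G : SimpleGraph α) [DecidableRel G.Adj]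

/-- The independent subsets of a finite set of vertices. -/
def indepSubsets (Y : Finset α) : Finset (Finset α) :=
  Y.powerset.filter fun S => ∀ u ∈ S, ∀ w ∈ S, ¬ G.Adj u w

/-- The partition function of the hard-core model with fugacity `t` on a finite set of vertices. -/
def partitionFn (t : ℝ) (Y : Finset α) : ℝ := ∑ S ∈ G.indepSubsets Y, t ^ S.card

variable {G}

theorem mem_indepSubsets {Y S : Finset α} :
    S ∈ G.indepSubsets Y ↔ S ⊆ Y ∧ ∀ u ∈ S, ∀ w ∈ S, ¬ G.Adj u w := by
  simp [indepSubsets]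

theorem one_le_partitionFn {t : ℝ} (ht : 0 ≤ t) (Y : Finset α) : 1 ≤ G.partitionFn t Y := by
  have h : (∅ : Finset α) ∈ G.indepSubsets Y := by simp [mem_indepSubsets]
  have := Finset.single_le_sum (f := fun S : Finset α => t ^ S.card)
    (fun S _ => pow_nonneg ht _) h
  simpa [partitionFn] using this

theorem partitionFn_le {t : ℝ} (ht : 0 ≤ t) (Y : Finset α) :
    G.partitionFn t Y ≤ (1 + t) ^ Y.card := by
  calc G.partitionFn t Y ≤ ∑ S ∈ Y.powerset, t ^ S.card :=
        Finset.sum_le_sum_of_subset_of_nonneg (Finset.filter_subset _ _)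
          fun S _ _ => pow_nonneg ht _
    _ = (1 + t) ^ Y.card := by
        have := Finset.sum_pow_mul_eq_add_pow t 1 Y
        simpa [add_comm] using this

variable [DecidableEq α]

/-- The independent sets containing `u` correspond to those avoiding `u` and its neighbours. -/
theorem sum_filter_mem_indepSubsets (t : ℝ) {Y : Finset α} {u : α} (hu : u ∈ Y) :
    ∑ S ∈ G.indepSubsets Y with u ∈ S, t ^ S.card
      = t * ∑ S ∈ G.indepSubsets Y with u ∉ S ∧ ∀ w ∈ S, ¬ G.Adj u w, t ^ S.card := by
  rw [Finset.mul_sum]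
  refine Finset.sum_bij' (fun S _ => S.erase u) (fun S _ => insert u S) ?_ ?_ ?_ ?_ ?_
  · intro S hS
    simp only [Finset.mem_filter, mem_indepSubsets] at hS ⊢
    obtain ⟨⟨h1, h2⟩, h3⟩ := hS
    refine ⟨⟨(Finset.erase_subset _ _).trans h1, fun a ha b hb =>
      h2 a (Finset.mem_of_mem_erase ha) b (Finset.mem_of_mem_erase hb)⟩, by simp,
      fun w hw => h2 u h3 w (Finset.mem_of_mem_erase hw)⟩
  · intro S hS
    simp only [Finset.mem_filter, mem_indepSubsets] at hS ⊢
    obtain ⟨⟨h1, h2⟩, h3, h4⟩ := hS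
    refine ⟨⟨Finset.insert_subset hu h1, ?_⟩, Finset.mem_insert_self _ _⟩
    intro a ha b hb
    rcases Finset.mem_insert.1 ha with rfl | ha' <;> rcases Finset.mem_insert.1 hb with rfl | hb'
    · exact G.irrefl
    · exact h4 b hb'
    · exact fun h => h4 a ha' h.symm
    · exact h2 a ha' b hb'
  · intro S hS
    exact Finset.insert_erase (Finset.mem_filter.1 hS).2
  · intro S hS
    exact Finset.erase_insert (Finset.mem_filter.1 hS).2.1
  · intro S hS
    have h := (Finset.mem_filter.1 hS).2
    rw [← Finset.card_erase_add_one h, pow_succ']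

/-- If A is the weight of the sets containing u, dropping the condition on the neighbours of u gives
A ≤ t(Z - A). -/
theorem sum_filter_mem_le {t : ℝ} (ht : 0 ≤ t) {Y : Finset α} {u : α} (hu : u ∈ Y) :
    ∑ S ∈ G.indepSubsets Y with u ∈ S, t ^ S.card ≤ t / (1 + t) * G.partitionFn t Y := by
  have h1 := sum_filter_mem_indepSubsets (G := G) t hu
  have h2 : ∑ S ∈ G.indepSubsets Y with u ∉ S ∧ ∀ w ∈ S, ¬ G.Adj u w, t ^ S.card
      ≤ ∑ S ∈ G.indepSubsets Y with u ∉ S, t ^ S.card :=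
    Finset.sum_le_sum_of_subset_of_nonneg
      (Finset.monotone_filter_right _ fun S _ h => h.1) fun S _ _ => pow_nonneg ht _
  have h3 := Finset.sum_filter_add_sum_filter_not (G.indepSubsets Y) (fun S => u ∈ S)
    fun S => t ^ S.card
  rw [div_mul_eq_mul_div, le_div_iff₀ (by positivity), partitionFn, ← h3]
  nlinarith [mul_le_mul_of_nonneg_left h2 ht]

/-- Union bound: an independent set contains u, or contains a neighbour of u, or avoids both. The
first kind weighs t times the third, and each neighbour accounts for at most t/(1+t) of the total.
-/
theorem le_sum_filter_mem {t : ℝ} (ht : 0 ≤ t) {Y : Finset α} {u : α} (hu : u ∈ Y) :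
    t / (1 + t) * (1 - (Y.filter (G.Adj u)).card * (t / (1 + t))) * G.partitionFn t Y
      ≤ ∑ S ∈ G.indepSubsets Y with u ∈ S, t ^ S.card := by
  have h1 := sum_filter_mem_indepSubsets (G := G) t hu
  set F := ∑ S ∈ G.indepSubsets Y with u ∉ S ∧ ∀ w ∈ S, ¬ G.Adj u w, t ^ S.card
  set A := ∑ S ∈ G.indepSubsets Y with u ∈ S, t ^ S.card
  have hcover : G.partitionFn t Y ≤ A + F +
      ∑ w ∈ Y.filter (G.Adj u), ∑ S ∈ G.indepSubsets Y with w ∈ S, t ^ S.card := by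
    simp only [A, F, partitionFn, Finset.sum_filter (s := G.indepSubsets Y)]
    rw [Finset.sum_comm, ← Finset.sum_add_distrib, ← Finset.sum_add_distrib]
    refine Finset.sum_le_sum fun S hS => ?_
    have hp : 0 ≤ t ^ S.card := pow_nonneg ht _
    have hnn : 0 ≤ ∑ w ∈ Y.filter (G.Adj u), if w ∈ S then t ^ S.card else 0 :=
      Finset.sum_nonneg fun w _ => by split_ifs <;> simp [hp]
    by_cases hu' : u ∈ S
    · simp [hu']; simpa using hnn
    by_cases hn : ∀ w ∈ S, ¬ G.Adj u w
    · simp only [hu', if_false, not_false_eq_true, true_and, if_pos hn]; linarith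
    · push Not at hn
      obtain ⟨w, hw, hadj⟩ := hn
      have hwY : w ∈ Y.filter (G.Adj u) :=
        Finset.mem_filter.2 ⟨(mem_indepSubsets.1 hS).1 hw, hadj⟩
      have := Finset.single_le_sum (f := fun w => if w ∈ S then t ^ S.card else 0)
        (fun w _ => by split_ifs <;> simp [hp]) hwY
      simp only [hw, if_true] at this
      have h0 : (0:ℝ) ≤ if u ∉ S ∧ ∀ w ∈ S, ¬ G.Adj u w then t ^ S.card else 0 := by
        split_ifs <;> simp [hp]
      simp only [hu', if_false] at h0 ⊢
      linarith
  have hsum : ∑ w ∈ Y.filter (G.Adj u), ∑ S ∈ G.indepSubsets Y with w ∈ S, t ^ S.card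
      ≤ (Y.filter (G.Adj u)).card * (t / (1 + t) * G.partitionFn t Y) := by
    rw [← nsmul_eq_mul]
    exact Finset.sum_le_card_nsmul _ _ _ fun w hw =>
      sum_filter_mem_le ht (Finset.mem_filter.1 hw).1
  have h1t : 0 < 1 + t := by linarith
  have key : (1 - (Y.filter (G.Adj u)).card * (t / (1 + t))) * G.partitionFn t Y
      ≤ F * (1 + t) := by
    rw [h1] at hcover; linarith
  rw [h1, mul_assoc, div_mul_eq_mul_div, div_le_iff₀ h1t, mul_assoc]
  exact mul_le_mul_of_nonneg_left key ht

theorem sum_card_mul_eq (t : ℝ) (Y : Finset α) :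
    ∑ S ∈ G.indepSubsets Y, t ^ S.card * S.card
      = ∑ u ∈ Y, ∑ S ∈ G.indepSubsets Y with u ∈ S, t ^ S.card := by
  simp only [Finset.sum_filter]
  rw [Finset.sum_comm]
  refine Finset.sum_congr rfl fun S hS => ?_
  rw [← Finset.sum_filter, Finset.filter_mem_eq_inter,
    Finset.inter_eq_right.2 (mem_indepSubsets.1 hS).1]
  simp [mul_comm]

/-- A lower bound for the mean size of an independent set in a sparse graph. -/
theorem le_sum_card_mul {t : ℝ} (ht : 0 ≤ t) (Y : Finset α) :
    (Y.card * (t / (1 + t)) - (∑ u ∈ Y, ((Y.filter (G.Adj u)).card : ℝ)) * (t / (1 + t)) ^ 2)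
        * G.partitionFn t Y
      ≤ ∑ S ∈ G.indepSubsets Y, t ^ S.card * S.card := by
  rw [sum_card_mul_eq]
  refine le_trans (le_of_eq ?_) (Finset.sum_le_sum fun u hu => le_sum_filter_mem ht hu)
  rw [← Finset.sum_mul, ← Finset.mul_sum, Finset.sum_sub_distrib, ← Finset.sum_mul]
  simp only [Finset.sum_const, nsmul_eq_mul, mul_one]
  ring

/-- The local inequality of the hard-core model: either few vertices of the neighbourhood `Y` are
available and the central vertex is likely to be chosen, or many are and several are chosen. -/
theorem local_occupancy {t a T : ℝ} (ht : 0 ≤ t) (hT : 0 ≤ T) (Y : Finset α)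
    (hY : (∑ u ∈ Y, ((Y.filter (G.Adj u)).card : ℝ)) * t ^ 2 ≤ 1)
    (ha : T * Real.exp ((T + 1) * (1 + t)) ≤ (a - T) * t) :
    0 ≤ t * (a - T) + ∑ S ∈ G.indepSubsets Y, t ^ S.card * (S.card - T) := by
  have hZ := one_le_partitionFn (G := G) ht Y
  have h1t : 0 < 1 + t := by linarith
  have hsub : ∑ S ∈ G.indepSubsets Y, t ^ S.card * (S.card - T)
      = ∑ S ∈ G.indepSubsets Y, t ^ S.card * S.card - T * G.partitionFn t Y := by
    rw [partitionFn, Finset.mul_sum, ← Finset.sum_sub_distrib]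
    exact Finset.sum_congr rfl fun S _ => by ring
  have haT : 0 ≤ (a - T) * t := le_trans (by positivity) ha
  rw [hsub]
  set q := t / (1 + t) with hq
  have hq0 : 0 ≤ q := by positivity
  have hqt : q ≤ t := div_le_self ht (by linarith)
  -- The extra 1 pays for the edge correction, which `hY` bounds by 1 because q ≤ t.
  by_cases hm : T + 1 ≤ Y.card * q
  · have hB := le_sum_card_mul (G := G) ht Y
    have hq2 : (∑ u ∈ Y, ((Y.filter (G.Adj u)).card : ℝ)) * q ^ 2 ≤ 1 :=
      le_trans (mul_le_mul_of_nonneg_left (pow_le_pow_left₀ hq0 hqt 2) (by positivity)) hY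
    have : T * G.partitionFn t Y ≤ (Y.card * q
        - (∑ u ∈ Y, ((Y.filter (G.Adj u)).card : ℝ)) * q ^ 2) * G.partitionFn t Y :=
      mul_le_mul_of_nonneg_right (by linarith) (by linarith)
    linarith
  · push Not at hm
    have hB : 0 ≤ ∑ S ∈ G.indepSubsets Y, t ^ S.card * S.card :=
      Finset.sum_nonneg fun S _ => by positivity
    have hmt : Y.card * t ≤ (T + 1) * (1 + t) := by
      have : Y.card * t = Y.card * q * (1 + t) := by rw [hq]; field_simp
      rw [this]; exact mul_le_mul_of_nonneg_right hm.le h1t.le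
    -- Here the sum is at least -T·Z, and this bound on Z lets the term t(a - T) of the central
    -- vertex compensate.
    have hZe : G.partitionFn t Y ≤ Real.exp ((T + 1) * (1 + t)) := by
      calc G.partitionFn t Y ≤ (1 + t) ^ Y.card := partitionFn_le ht Y
        _ ≤ Real.exp t ^ Y.card := pow_le_pow_left₀ h1t.le (by linarith [Real.add_one_le_exp t]) _
        _ = Real.exp (Y.card * t) := by rw [← Real.exp_nat_mul]
        _ ≤ _ := Real.exp_le_exp.2 hmt
    have := mul_le_mul_of_nonneg_left hZe hT
    linarith

/-! ### From the local inequality to a large independent set. -/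

variable [Fintype α]

/-- The contribution of the independent sets containing `v` with a given part `H` away from `v`. -/
theorem sum_fiber_mem {v : α} {N H : Finset α} (t a T : ℝ)
    (hN : ∀ u, u ∈ N ↔ G.Adj v u) (hHd : Disjoint H (insert v N))
    (hHi : ∀ u ∈ H, ∀ w ∈ H, ¬ G.Adj u w) :
    ∑ S ∈ ((G.indepSubsets Finset.univ).filter fun S => S \ insert v N = H).filter
      (fun S => v ∈ S), t ^ S.card * ((if v ∈ S then a else 0) + (S ∩ N).card - T)
      = t ^ H.card * (t * (a - T)) := by
  have hvN : v ∉ N := fun h => G.irrefl ((hN v).1 h)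
  have hvH : v ∉ H := fun h => Finset.disjoint_left.1 hHd h (Finset.mem_insert_self _ _)
  have hNH : ∀ u ∈ N, u ∉ H := fun u hu h =>
    Finset.disjoint_left.1 hHd h (Finset.mem_insert_of_mem hu)
  have : ((G.indepSubsets Finset.univ).filter fun S => S \ insert v N = H).filter
    (fun S => v ∈ S) = {insert v H} := by
    ext S
    simp only [Finset.mem_filter, mem_indepSubsets, Finset.mem_singleton, Finset.subset_univ,
      true_and]
    constructor
    · rintro ⟨⟨hS, rfl⟩, hvS⟩
      ext x
      have : x ∈ S → x ∉ N := fun hx hxN => hS v hvS x hx ((hN x).1 hxN)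
      simp only [Finset.mem_insert, Finset.mem_sdiff]
      grind
    · rintro rfl
      refine ⟨⟨?_, ?_⟩, Finset.mem_insert_self _ _⟩
      · have hv' : ∀ w ∈ H, ¬ G.Adj v w := fun w hw h => hNH w ((hN w).2 h) hw
        intro x hx y hy
        rcases Finset.mem_insert.1 hx with rfl | hx' <;>
          rcases Finset.mem_insert.1 hy with rfl | hy'
        · exact G.irrefl
        · exact hv' y hy'
        · exact fun h => hv' x hx' h.symm
        · exact hHi x hx' y hy'
      · ext x
        simp only [Finset.mem_insert, Finset.mem_sdiff]
        grind
  rw [this, Finset.sum_singleton, Finset.card_insert_of_notMem hvH]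
  have : insert v H ∩ N = ∅ := by
    ext x; simp only [Finset.mem_inter, Finset.mem_insert, Finset.notMem_empty, iff_false]; grind
  rw [this]
  simp
  ring

/-- The contribution of the independent sets avoiding `v` with a given part `H` away from `v`. -/
theorem sum_fiber_notMem {v : α} {N H : Finset α} (t a T : ℝ)
    (hN : ∀ u, u ∈ N ↔ G.Adj v u) (hHd : Disjoint H (insert v N))
    (hHi : ∀ u ∈ H, ∀ w ∈ H, ¬ G.Adj u w) :
    ∑ S ∈ ((G.indepSubsets Finset.univ).filter fun S => S \ insert v N = H).filter
      (fun S => ¬ v ∈ S), t ^ S.card * ((if v ∈ S then a else 0) + (S ∩ N).card - T)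
      = t ^ H.card * ∑ U ∈ G.indepSubsets (N.filter fun u => ∀ w ∈ H, ¬ G.Adj u w),
          t ^ U.card * (U.card - T) := by
  have hvN : v ∉ N := fun h => G.irrefl ((hN v).1 h)
  have hvH : v ∉ H := fun h => Finset.disjoint_left.1 hHd h (Finset.mem_insert_self _ _)
  have hNH : ∀ u ∈ N, u ∉ H := fun u hu h =>
    Finset.disjoint_left.1 hHd h (Finset.mem_insert_of_mem hu)
  set X := N.filter fun u => ∀ w ∈ H, ¬ G.Adj u w with hX
  have hXN : X ⊆ N := Finset.filter_subset _ _
  rw [Finset.mul_sum]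
  refine Finset.sum_bij' (fun S _ => S ∩ N) (fun U _ => U ∪ H) ?_ ?_ ?_ ?_ ?_
  · intro S hS
    simp only [Finset.mem_filter, mem_indepSubsets, Finset.subset_univ, true_and] at hS ⊢
    obtain ⟨⟨hS, rfl⟩, hvS⟩ := hS
    refine ⟨fun x hx => ?_, fun x hx y hy =>
      hS x (Finset.mem_inter.1 hx).1 y (Finset.mem_inter.1 hy).1⟩
    rw [hX, Finset.mem_filter]
    exact ⟨(Finset.mem_inter.1 hx).2, fun w hw =>
      hS x (Finset.mem_inter.1 hx).1 w (Finset.mem_sdiff.1 hw).1⟩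
  · intro U hU
    simp only [Finset.mem_filter, mem_indepSubsets, Finset.subset_univ, true_and] at hU ⊢
    obtain ⟨hUX, hU⟩ := hU
    have hUH : ∀ x ∈ U, ∀ w ∈ H, ¬ G.Adj x w := fun x hx => (Finset.mem_filter.1 (hUX hx)).2
    refine ⟨⟨?_, ?_⟩, ?_⟩
    · intro x hx y hy
      rcases Finset.mem_union.1 hx with hx | hx <;> rcases Finset.mem_union.1 hy with hy | hy
      · exact hU x hx y hy
      · exact hUH x hx y hy
      · exact fun h => hUH y hy x hx h.symm
      · exact hHi x hx y hy
    · ext x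
      have := @hUX x
      have := @hXN x
      simp only [Finset.mem_insert, Finset.mem_sdiff, Finset.mem_union]
      grind
    · have := @hUX v
      have := @hXN v
      simp only [Finset.mem_union]
      grind
  · intro S hS
    simp only [Finset.mem_filter, mem_indepSubsets, Finset.subset_univ, true_and] at hS
    obtain ⟨⟨hS, rfl⟩, hvS⟩ := hS
    ext x
    simp only [Finset.mem_insert, Finset.mem_sdiff, Finset.mem_union, Finset.mem_inter]
    grind
  · intro U hU
    have hUX := (mem_indepSubsets.1 hU).1
    ext x
    have := @hUX x
    have := @hXN x
    simp only [Finset.mem_union, Finset.mem_inter]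
    grind
  · intro S hS
    simp only [Finset.mem_filter, mem_indepSubsets, Finset.subset_univ, true_and] at hS
    obtain ⟨⟨hS, rfl⟩, hvS⟩ := hS
    have hc : S.card = (S \ insert v N).card + (S ∩ N).card := by
      rw [← Finset.card_union_of_disjoint]
      · congr 1
        ext x
        simp only [Finset.mem_insert, Finset.mem_sdiff, Finset.mem_union, Finset.mem_inter]
        grind
      · rw [Finset.disjoint_left]; simp; grind
    rw [hc, pow_add, if_neg hvS]
    ring

/-- The local inequality, summed over all independent sets. -/
theorem sum_local_occupancy_nonneg {t a T : ℝ} (ht : 0 ≤ t) (hT : 0 ≤ T) (v : α)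
    (hv : (∑ u ∈ G.neighborFinset v,
      (((G.neighborFinset v).filter (G.Adj u)).card : ℝ)) * t ^ 2 ≤ 1)
    (ha : T * Real.exp ((T + 1) * (1 + t)) ≤ (a - T) * t) :
    0 ≤ ∑ S ∈ G.indepSubsets Finset.univ,
      t ^ S.card * ((if v ∈ S then a else 0) + (S ∩ G.neighborFinset v).card - T) := by
  set N := G.neighborFinset v with hN
  have hN' : ∀ u, u ∈ N ↔ G.Adj v u := by simp [hN]
  -- Condition on the part H of S outside the closed neighbourhood of v. Given H, either S = H ∪
  -- {v}, or S adds to H an independent set of unblocked neighbours.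
  rw [← Finset.sum_fiberwise (G.indepSubsets Finset.univ) (fun S => S \ insert v N)]
  refine Finset.sum_nonneg fun H _ => ?_
  by_cases hH : Disjoint H (insert v N) ∧ ∀ u ∈ H, ∀ w ∈ H, ¬ G.Adj u w
  swap
  · rw [Finset.filter_eq_empty_iff.2, Finset.sum_empty]
    rintro S hS rfl
    have hS' := (mem_indepSubsets.1 hS).2
    refine hH ⟨Finset.sdiff_disjoint, fun u hu w hw => ?_⟩
    exact hS' u (Finset.sdiff_subset hu) w (Finset.sdiff_subset hw)
  obtain ⟨hHd, hHi⟩ := hH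
  set X := N.filter fun u => ∀ w ∈ H, ¬ G.Adj u w with hX
  have hXN : X ⊆ N := Finset.filter_subset _ _
  rw [← Finset.sum_filter_add_sum_filter_not _ (fun S : Finset α => v ∈ S)]
  rw [sum_fiber_mem t a T hN' hHd hHi, sum_fiber_notMem t a T hN' hHd hHi, ← mul_add]
  refine mul_nonneg (pow_nonneg ht _) (local_occupancy ht hT X (le_trans ?_ hv) ha)
  refine mul_le_mul_of_nonneg_right ?_ (by positivity)
  calc (∑ u ∈ X, ((X.filter (G.Adj u)).card : ℝ))
      ≤ ∑ u ∈ X, ((N.filter (G.Adj u)).card : ℝ) := Finset.sum_le_sum fun u _ => by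
        exact_mod_cast Finset.card_le_card (Finset.filter_subset_filter _ hXN)
    _ ≤ _ := Finset.sum_le_sum_of_subset_of_nonneg hXN fun _ _ _ => by positivity

/-- A graph of bounded degree with sparse neighbourhoods has a large independent set. -/
theorem exists_indep_of_sparse_neighborhoods {t a T Δ : ℝ} (ht : 0 ≤ t) (hT : 0 ≤ T)
    (hdeg : ∀ v, (G.degree v : ℝ) ≤ Δ)
    (hv : ∀ v, (∑ u ∈ G.neighborFinset v,
      (((G.neighborFinset v).filter (G.Adj u)).card : ℝ)) * t ^ 2 ≤ 1)
    (ha : T * Real.exp ((T + 1) * (1 + t)) ≤ (a - T) * t) :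
    ∃ S : Finset α, (∀ u ∈ S, ∀ w ∈ S, ¬ G.Adj u w) ∧
      Fintype.card α * T ≤ (a + Δ) * S.card := by
  by_contra! hcon
  have h1 : 0 ≤ ∑ v, ∑ S ∈ G.indepSubsets Finset.univ,
      t ^ S.card * ((if v ∈ S then a else 0) + (S ∩ G.neighborFinset v).card - T) :=
    Finset.sum_nonneg fun v _ => sum_local_occupancy_nonneg ht hT v (hv v) ha
  rw [Finset.sum_comm] at h1
  have h2 : ∀ S ∈ G.indepSubsets Finset.univ,
      ∑ v, t ^ S.card * ((if v ∈ S then a else 0) + (S ∩ G.neighborFinset v).card - T)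
        ≤ t ^ S.card * ((a + Δ) * S.card - Fintype.card α * T) := by
    intro S _
    rw [← Finset.mul_sum]
    refine mul_le_mul_of_nonneg_left ?_ (pow_nonneg ht _)
    rw [Finset.sum_sub_distrib, Finset.sum_add_distrib]
    -- Double counting: each u ∈ S is counted once for every neighbour it has.
    have hd : (∑ v, ((S ∩ G.neighborFinset v).card : ℝ)) ≤ Δ * S.card := by
      have : ∀ v, ((S ∩ G.neighborFinset v).card : ℝ) = ∑ u ∈ S, if G.Adj u v then (1:ℝ) else 0 := by
        intro v
        rw [Finset.sum_boole]
        congr 2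
        ext u; simp [G.adj_comm]
      simp only [this]
      rw [Finset.sum_comm]
      calc _ ≤ ∑ u ∈ S, Δ := Finset.sum_le_sum fun u _ => by
            rw [Finset.sum_boole]
            refine le_trans (le_of_eq ?_) (hdeg u)
            rw [← card_neighborFinset_eq_degree]
            congr 2
            ext; simp
        _ = _ := by simp [mul_comm]
    simp only [Finset.sum_ite_mem, Finset.univ_inter, Finset.sum_const, nsmul_eq_mul,
      Finset.card_univ]
    linarith
  have h3 : ∑ S ∈ G.indepSubsets Finset.univ,
      t ^ S.card * ((a + Δ) * S.card - Fintype.card α * T) < 0 := by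
    -- Since t may be 0, strictness comes from the empty set, whose weight is 1; `hcon` at ∅ says
    -- that |α|·T > 0.
    refine Finset.sum_neg' (fun S hS => ?_) ⟨∅, by simp [mem_indepSubsets], ?_⟩
    · have := hcon S (mem_indepSubsets.1 hS).2
      exact mul_nonpos_of_nonneg_of_nonpos (pow_nonneg ht _) (by linarith)
    · have := hcon ∅ (by simp)
      simp at this ⊢
      linarith
  linarith [Finset.sum_le_sum h2]

/-- The greedy bound for independent sets. -/
theorem exists_indep_of_degree_le {Δ : ℕ} (hdeg : ∀ v, G.degree v ≤ Δ) :
    ∃ S : Finset α, (∀ u ∈ S, ∀ w ∈ S, ¬ G.Adj u w) ∧ Fintype.card α ≤ S.card * (Δ + 1) := by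
  obtain ⟨S, hS, hmax⟩ := Finset.exists_max_image (G.indepSubsets Finset.univ) Finset.card
    ⟨∅, by simp [mem_indepSubsets]⟩
  rw [mem_indepSubsets] at hS
  refine ⟨S, hS.2, ?_⟩
  -- Closed neighbourhoods of a maximum independent set cover the graph, since an uncovered vertex
  -- could be added.
  have hcov : (Finset.univ : Finset α) ⊆ S.biUnion fun u => insert u (G.neighborFinset u) := by
    intro x _
    by_contra hx
    simp only [Finset.mem_biUnion, Finset.mem_insert, mem_neighborFinset, not_exists, not_and,
      not_or] at hx
    have hxS : x ∉ S := fun h => (hx x h).1 rfl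
    have := hmax (insert x S) (mem_indepSubsets.2 ⟨Finset.subset_univ _, ?_⟩)
    · rw [Finset.card_insert_of_notMem hxS] at this; omega
    intro a ha b hb
    rcases Finset.mem_insert.1 ha with rfl | ha' <;> rcases Finset.mem_insert.1 hb with rfl | hb'
    · exact G.irrefl
    · exact fun h => (hx b hb').2 h.symm
    · exact (hx a ha').2
    · exact hS.2 a ha' b hb'
  calc Fintype.card α = (Finset.univ : Finset α).card := rfl
    _ ≤ _ := Finset.card_le_card hcov
    _ ≤ _ := Finset.card_biUnion_le_card_mul _ _ _ fun u _ =>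
      (Finset.card_insert_le _ _).trans (by simpa using hdeg u)

end HardCore

end SimpleGraph

namespace PermArray

open Finset Equiv

/-! ### Counting permutations by their supports. -/

section Counting

variable {α : Type*} [Fintype α] [DecidableEq α]

/-- At most `|A|!` permutations have prescribed values outside `A`. -/
theorem card_perm_eq_outside_le (A : Finset α) (g : α → α) :
    #{τ : Perm α | ∀ x ∉ A, τ x = g x} ≤ A.card.factorial := by
  rcases Finset.eq_empty_or_nonempty ({τ : Perm α | ∀ x ∉ A, τ x = g x} : Finset (Perm α))
    with h | ⟨τ₀, h₀⟩
  · simp [h]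
  have h₀' := (mem_filter.1 h₀).2
  have hc : Fintype.card {f : Perm α // ∀ a, ¬ a ∈ A → f a = a} = A.card.factorial := by
    rw [← Fintype.card_congr (Perm.subtypeEquivSubtypePerm (fun a => a ∈ A)), Fintype.card_perm,
      Fintype.card_coe]
  rw [← hc, Fintype.card_subtype]
  -- Dividing by one solution `τ₀` leaves permutations that fix every point outside A.
  refine card_le_card_of_injOn (fun τ => τ₀⁻¹ * τ) ?_ ((mul_right_injective τ₀⁻¹).injOn)
  intro τ hτ
  simp only [coe_filter, mem_univ, true_and, Set.mem_ofPred_eq] at hτ ⊢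
  intro a ha
  rw [Perm.mul_apply, hτ a ha, ← h₀' a ha, Perm.inv_def, Equiv.symm_apply_apply]

theorem card_support_eq (A : Finset α) :
    #{τ : Perm α | τ.support = A} = numDerangements A.card := by
  have := card_derangements_eq_numDerangements {a // a ∈ A}
  rw [Fintype.card_congr (derangements.subtypeEquiv (fun a => a ∈ A)), Fintype.card_coe] at this
  rw [← this, Fintype.card_subtype]
  congr 1
  ext τ
  simp only [mem_filter, mem_univ, true_and, Finset.ext_iff, Perm.mem_support,
    Function.mem_fixedPoints, Function.IsFixedPt]
  exact forall_congr' fun a => by tauto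

theorem card_card_support_eq_le (i : ℕ) :
    #{τ : Perm α | #τ.support = i} ≤ (Fintype.card α).choose i * numDerangements i := by
  rw [mul_comm, ← card_univ, ← card_powersetCard]
  refine card_le_mul_card_image_of_maps_to (f := fun τ : Perm α => τ.support) ?_ _ ?_
  · intro τ hτ
    exact mem_powersetCard.2 ⟨subset_univ _, (mem_filter.1 hτ).2⟩
  · intro A hA
    rw [← (mem_powersetCard.1 hA).2, ← card_support_eq A]
    exact card_le_card fun τ hτ => mem_filter.2 ⟨mem_univ _, (mem_filter.1 hτ).2⟩

/-- The number of permutations whose support meets that of `σ` in `k` points, on `l` of which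
they differ from `σ`. -/
theorem card_overlap_le (σ : Perm α) (j k l : ℕ) (hkj : k ≤ j) :
    #{τ : Perm α | #τ.support = j ∧ #(σ.support ∩ τ.support) = k ∧
        #{x ∈ σ.support ∩ τ.support | σ x ≠ τ x} = l}
      ≤ (#σ.support).choose k * (Fintype.card α - #σ.support).choose (j - k) * k.choose l *
        (l + j - k).factorial := by
  have hcard : (#σ.support).choose k * (Fintype.card α - #σ.support).choose (j - k)
      = #(powersetCard k σ.support ×ˢ powersetCard (j - k) σ.supportᶜ) := by
    rw [card_product, card_powersetCard, card_powersetCard, card_compl]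
  rw [mul_assoc, mul_comm, hcard]
  refine card_le_mul_card_image_of_maps_to
    (f := fun τ : Perm α => (σ.support ∩ τ.support, τ.support \ σ.support)) ?_ _ ?_
  · intro τ hτ
    obtain ⟨h1, h2, -⟩ := (mem_filter.1 hτ).2
    simp only [mem_product, mem_powersetCard]
    refine ⟨⟨inter_subset_left, h2⟩, fun x hx => mem_compl.2 (mem_sdiff.1 hx).2, ?_⟩
    rw [← h1, ← h2, inter_comm, card_sdiff, inter_comm]
  rintro ⟨K, M⟩ hKM
  simp only [mem_product, mem_powersetCard] at hKM
  obtain ⟨⟨-, hK⟩, -, hM⟩ := hKM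
  rw [mul_comm, ← hK, ← card_powersetCard]
  refine card_le_mul_card_image_of_maps_to
    (f := fun τ : Perm α => ({x ∈ K | σ x ≠ τ x} : Finset α)) ?_ _ ?_
  · intro τ hτ
    simp only [mem_filter, mem_univ, true_and, Prod.mk.injEq] at hτ
    obtain ⟨⟨-, -, h3⟩, rfl, -⟩ := hτ
    exact mem_powersetCard.2 ⟨filter_subset _ _, h3⟩
  intro Q hQ
  -- Once K, M and Q are chosen, τ agrees with σ on K \ Q and is the identity off K ∪ M, so only its
  -- values on Q ∪ M remain free.
  have hA : #(Q ∪ M) ≤ l + j - #K := by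
    have := card_union_le Q M
    have := (mem_powersetCard.1 hQ).2
    omega
  refine le_trans (card_le_card ?_) ((card_perm_eq_outside_le (Q ∪ M)
    (fun x => if x ∈ K then σ x else x)).trans (Nat.factorial_le hA))
  intro τ hτ
  simp only [mem_filter, mem_univ, true_and, Prod.mk.injEq] at hτ ⊢
  obtain ⟨⟨-, rfl, rfl⟩, rfl⟩ := hτ
  intro x hx
  simp only [mem_union, mem_filter, mem_inter, mem_sdiff, Perm.mem_support] at hx ⊢
  split_ifs with h
  · by_contra hne
    exact hx (Or.inl ⟨h, fun h' => hne h'.symm⟩)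
  · by_contra hne
    exact hx (Or.inr ⟨hne, fun h' => h ⟨h', hne⟩⟩)

end Counting

/-! ### Degrees and neighbourhood edges of the graph of close permutations. -/

section Graph

variable {n : ℕ}

theorem permDist_mul_left (c a b : Perm (Fin n)) : permDist (c * a) (c * b) = permDist a b := by
  simp [permDist, hammingDist]

theorem permDist_comm (a b : Perm (Fin n)) : permDist a b = permDist b a :=
  hammingDist_comm _ _

theorem permDist_one_left (a : Perm (Fin n)) : permDist 1 a = #a.support := by
  simp only [permDist, hammingDist, Perm.support, Perm.one_apply]
  exact congrArg card (filter_congr fun i _ => ne_comm)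

/-- A point moved by exactly one of σ, τ is always a disagreement, and a point moved by neither
never is; only the common support needs a separate count. -/
theorem permDist_eq (σ τ : Perm (Fin n)) :
    permDist σ τ + 2 * #(σ.support ∩ τ.support) = #σ.support + #τ.support +
      #{x ∈ σ.support ∩ τ.support | σ x ≠ τ x} := by
  have h : ({x | σ x ≠ τ x} : Finset (Fin n)) = (σ.support \ τ.support ∪ τ.support \ σ.support) ∪
      {x ∈ σ.support ∩ τ.support | σ x ≠ τ x} := by
    ext x
    simp only [mem_filter, mem_univ, true_and, mem_union, mem_sdiff, mem_inter, Perm.mem_support]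
    by_cases h1 : σ x = x <;> by_cases h2 : τ x = x <;> simp [h1, h2]
    exact fun h => h2 h.symm
  have h1 := card_sdiff_add_card_inter σ.support τ.support
  have h2 := card_sdiff_add_card_inter τ.support σ.support
  rw [inter_comm] at h2
  have h3 : permDist σ τ = #({x | σ x ≠ τ x} : Finset (Fin n)) := rfl
  rw [h3, h, card_union_of_disjoint, card_union_of_disjoint]
  · omega
  · rw [disjoint_left]; simp; tauto
  · rw [disjoint_left]; simp; tauto

/-- `L` bounds the number of permutations of weight `j` close to a given one of weight `i`. -/
theorem card_close_le_L (d j : ℕ) (σ : Perm (Fin n)) :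
    #{τ : Perm (Fin n) | #τ.support = j ∧ permDist σ τ < d} ≤ L n d (#σ.support) j := by
  set i := #σ.support with hi
  have hsub : ({τ : Perm (Fin n) | #τ.support = j ∧ permDist σ τ < d} : Finset _) ⊆
      (Icc ⌈((i : ℚ) + j - d + 1) / 2⌉₊ (min i j)).biUnion fun k =>
        (Icc 0 (min (d + 2 * k - i - j - 1) k)).biUnion fun l =>
          {τ : Perm (Fin n) | #τ.support = j ∧ #(σ.support ∩ τ.support) = k ∧
            #{x ∈ σ.support ∩ τ.support | σ x ≠ τ x} = l} := by
    intro τ hτ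
    obtain ⟨h1, h2⟩ := (mem_filter.1 hτ).2
    have h3 := permDist_eq σ τ
    have h4 : #(σ.support ∩ τ.support) ≤ i := card_le_card inter_subset_left
    have h5 : #(σ.support ∩ τ.support) ≤ #τ.support := card_le_card inter_subset_right
    have h6 : #{x ∈ σ.support ∩ τ.support | σ x ≠ τ x} ≤ #(σ.support ∩ τ.support) :=
      card_filter_le _ _
    simp only [mem_biUnion, mem_Icc, mem_filter, mem_univ, true_and]
    refine ⟨_, ⟨?_, by omega⟩, _, ⟨Nat.zero_le _, ?_⟩, h1, rfl, rfl⟩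
    -- The distance is i + j - 2k + l, so being below d bounds l from above; l ≥ 0 then bounds k
    -- from below.
    · rw [Nat.ceil_le, div_le_iff₀ (by norm_num)]
      have : i + j + 1 ≤ 2 * #(σ.support ∩ τ.support) + d := by omega
      have : (i : ℚ) + j + 1 ≤ 2 * #(σ.support ∩ τ.support) + d := by exact_mod_cast this
      linarith
    · omega
  refine (card_le_card hsub).trans (card_biUnion_le.trans (sum_le_sum fun k hk =>
    card_biUnion_le.trans (sum_le_sum fun l _ => ?_)))
  have := card_overlap_le σ j k l ((mem_Icc.1 hk).2.trans (min_le_right _ _))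
  rwa [Fintype.card_fin] at this

/-- The term k = i, l = 0 equals 1; it accounts for the given permutation itself. -/
theorem one_le_L_self {d i : ℕ} (hi : i < d) : 1 ≤ L n d i i := by
  have hk : i ∈ Icc ⌈((i : ℚ) + i - d + 1) / 2⌉₊ (min i i) := by
    rw [mem_Icc, Nat.ceil_le, div_le_iff₀ (by norm_num)]
    have : (i : ℚ) + 1 ≤ d := by exact_mod_cast hi
    exact ⟨by linarith, by simp⟩
  have hl : 0 ∈ Icc 0 (min (d + 2 * i - i - i - 1) i) := by simp
  refine le_trans ?_ (single_le_sum (fun _ _ => Nat.zero_le _) hk)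
  refine le_trans ?_ (single_le_sum (fun _ _ => Nat.zero_le _) hl)
  simp

theorem V_eq (n r : ℕ) : V n r = ∑ i ∈ Icc 2 r, n.choose i * numDerangements i + 1 := by
  unfold V
  rcases Nat.eq_zero_or_pos r with rfl | hr
  · simp
  have h : Icc 0 r = insert 0 (insert 1 (Icc 2 r)) := by
    ext i
    simp only [mem_Icc, mem_insert]
    omega
  rw [h, sum_insert (by simp), sum_insert (by simp)]
  simp [add_comm]

theorem E_eq (n r : ℕ) : 6 * E n r =
    ((∑ i ∈ Icc 2 r, ∑ j ∈ Icc 2 r, n.choose i * numDerangements i * L n (r + 1) i j : ℕ) : ℝ) := by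
  unfold E
  push_cast
  ring

/-- The diagonal terms j = i alone suffice. This keeps E from being small when V is large. -/
theorem V_le_six_mul_E (n r : ℕ) : (V n r : ℝ) - 1 ≤ 6 * E n r := by
  rw [E_eq, V_eq]
  push_cast
  rw [add_sub_cancel_right]
  norm_cast
  refine sum_le_sum fun i hi => ?_
  refine le_trans ?_ (single_le_sum (f := fun j => n.choose i * numDerangements i * L n (r + 1) i j)
    (fun _ _ => Nat.zero_le _) hi)
  exact Nat.le_mul_of_pos_right _ (one_le_L_self (Nat.lt_succ_of_le (mem_Icc.1 hi).2))

/-- The graph joining distinct permutations at distance less than `d`. -/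
def closeGraph (n d : ℕ) : SimpleGraph (Perm (Fin n)) where
  Adj a b := a ≠ b ∧ permDist a b < d
  symm := ⟨fun a b h => ⟨h.1.symm, permDist_comm a b ▸ h.2⟩⟩
  loopless := ⟨fun _ h => h.1 rfl⟩

instance (n d : ℕ) : DecidableRel (closeGraph n d).Adj :=
  fun a b => inferInstanceAs (Decidable (a ≠ b ∧ permDist a b < d))

theorem closeGraph_adj {d : ℕ} {a b : Perm (Fin n)} :
    (closeGraph n d).Adj a b ↔ a ≠ b ∧ permDist a b < d := Iff.rfl

theorem closeGraph_adj_mul_left {d : ℕ} (c : Perm (Fin n)) {a b : Perm (Fin n)} :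
    (closeGraph n d).Adj (c * a) (c * b) ↔ (closeGraph n d).Adj a b := by
  simp [closeGraph_adj, permDist_mul_left]

/-- Left multiplication is an automorphism of the graph, so only the neighbourhood of 1 has to be
studied. -/
theorem neighborFinset_eq_map (d : ℕ) (v : Perm (Fin n)) :
    (closeGraph n d).neighborFinset v =
      ((closeGraph n d).neighborFinset 1).map (Equiv.mulLeft v).toEmbedding := by
  ext a
  rw [mem_map_equiv, SimpleGraph.mem_neighborFinset, SimpleGraph.mem_neighborFinset,
    ← closeGraph_adj_mul_left v (a := 1)]
  simp

theorem card_support_mem_Icc {r : ℕ} {σ : Perm (Fin n)}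
    (h : σ ∈ (closeGraph n (r + 1)).neighborFinset 1) : #σ.support ∈ Icc 2 r := by
  rw [SimpleGraph.mem_neighborFinset, closeGraph_adj, permDist_one_left] at h
  exact mem_Icc.2 ⟨Perm.two_le_card_support_of_ne_one h.1.symm, Nat.lt_succ_iff.1 h.2⟩

/-- Neighbours of 1 are grouped by support size. Taking f = 1 bounds the degree; taking f(i) = ∑ⱼ
L_{i,j} bounds the edges inside a neighbourhood. -/
theorem sum_neighborFinset_one_le (r : ℕ) (f : ℕ → ℕ) :
    ∑ σ ∈ (closeGraph n (r + 1)).neighborFinset 1, f (#σ.support)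
      ≤ ∑ i ∈ Icc 2 r, n.choose i * numDerangements i * f i := by
  rw [← sum_fiberwise_of_maps_to (fun σ hσ => card_support_mem_Icc hσ)]
  refine sum_le_sum fun i _ => ?_
  rw [sum_congr rfl (g := fun _ => f i) (fun σ hσ => by rw [(mem_filter.1 hσ).2]), sum_const,
    smul_eq_mul]
  refine Nat.mul_le_mul_right _ ?_
  have := card_card_support_eq_le (α := Fin n) i
  rw [Fintype.card_fin] at this
  exact (card_le_card (filter_subset_filter _ (subset_univ _))).trans this

theorem degree_closeGraph_le (r : ℕ) (v : Perm (Fin n)) :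
    (closeGraph n (r + 1)).degree v + 1 ≤ V n r := by
  rw [← SimpleGraph.card_neighborFinset_eq_degree, neighborFinset_eq_map, card_map, V_eq]
  have := sum_neighborFinset_one_le (n := n) r (fun _ => 1)
  simpa using this

theorem sum_card_common_neighbors_le (r : ℕ) (v : Perm (Fin n)) :
    (∑ u ∈ (closeGraph n (r + 1)).neighborFinset v,
      ((((closeGraph n (r + 1)).neighborFinset v).filter
        ((closeGraph n (r + 1)).Adj u)).card : ℝ)) ≤ 6 * E n r := by
  rw [E_eq]
  norm_cast
  rw [neighborFinset_eq_map, sum_map]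
  simp only [filter_map, card_map]
  refine le_trans (sum_le_sum (g := fun σ => ∑ j ∈ Icc 2 r, L n (r + 1) (#σ.support) j)
    fun σ _ => ?_) ((sum_neighborFinset_one_le r fun i => ∑ j ∈ Icc 2 r, L n (r + 1) i j).trans
      (le_of_eq (sum_congr rfl fun i _ => by rw [mul_sum])))
  have hsub : ((closeGraph n (r + 1)).neighborFinset 1).filter
      ((closeGraph n (r + 1)).Adj (v * σ) ∘ (Equiv.mulLeft v).toEmbedding) ⊆
      (Icc 2 r).biUnion fun j => {τ : Perm (Fin n) | #τ.support = j ∧ permDist σ τ < r + 1} := by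
    intro τ hτ
    obtain ⟨h1, h2⟩ := mem_filter.1 hτ
    have h3 : (closeGraph n (r + 1)).Adj σ τ := (closeGraph_adj_mul_left v).1 h2
    exact mem_biUnion.2 ⟨_, card_support_mem_Icc h1, mem_filter.2 ⟨mem_univ _, rfl, h3.2⟩⟩
  exact (card_le_card hsub).trans (card_biUnion_le.trans (sum_le_sum fun j _ =>
    card_close_le_L (r + 1) j σ))

theorem card_le_P {d : ℕ} {S : Finset (Perm (Fin n))}
    (hS : ∀ u ∈ S, ∀ w ∈ S, ¬ (closeGraph n d).Adj u w) : #S ≤ P n d := by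
  classical
  refine le_sup (f := card) (mem_filter.2 ⟨mem_univ _, fun a ha b hb hab => ?_⟩)
  by_contra hlt
  exact hS a ha b hb ⟨hab, not_le.1 hlt⟩

end Graph

end PermArray

/-! ### The greedy bound, the choice of parameters and the conclusion. -/

theorem PermArray.factorial_le_P_mul_V (n r : ℕ) : n.factorial ≤ P n (r + 1) * V n r := by
  obtain ⟨S, hS, hcard⟩ := SimpleGraph.exists_indep_of_degree_le (G := closeGraph n (r + 1))
    (Δ := V n r - 1) fun v => by have := degree_closeGraph_le r v; omega
  rw [Fintype.card_perm, Fintype.card_fin,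
    Nat.sub_add_cancel (by rw [V_eq]; omega)] at hcard
  exact hcard.trans (Nat.mul_le_mul_right _ (card_le_P hS))

/-- This is the condition on a in `local_occupancy`, with a·t = 2^(5T)/3. Put w = 2^T. As 1 + t ≤
4/3 < 2 log 2, the exponential is at most 4^(T+1) = 4w², and T ≤ w/2; so the left side is at most
2w³, while w⁵ ≥ 16w³. -/
theorem mul_exp_le_two_rpow {T t : ℝ} (hT : 2 ≤ T) (ht0 : 0 ≤ t) (ht : t ≤ 1 / 3) :
    T * Real.exp ((T + 1) * (1 + t)) ≤ (2 : ℝ) ^ (5 * T) / 3 - T * t := by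
  have hlog := Real.log_two_gt_d9
  set w : ℝ := (2 : ℝ) ^ T with hw
  have hwe : w = Real.exp (Real.log 2 * T) := Real.rpow_def_of_pos (by norm_num) T
  have hw4 : 4 ≤ w := by
    have := Real.rpow_le_rpow_of_exponent_le (x := 2) (by norm_num) hT
    norm_num at this
    exact this
  have hTw : 2 * T ≤ w := by
    have h1 : w = 4 * Real.exp (Real.log 2 * (T - 2)) := by
      rw [hwe, show Real.log 2 * T = Real.log 2 * (T - 2) + Real.log 2 + Real.log 2 by ring,
        Real.exp_add, Real.exp_add, Real.exp_log (by norm_num)]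
      ring
    have h2 := Real.add_one_le_exp (Real.log 2 * (T - 2))
    nlinarith [mul_nonneg (by linarith : (0:ℝ) ≤ Real.log 2 - 1 / 2) (by linarith : 0 ≤ T - 2)]
  have h5 : (2 : ℝ) ^ (5 * T) = w ^ 5 := by
    rw [hw, ← Real.rpow_natCast, ← Real.rpow_mul (by norm_num)]
    push_cast
    ring_nf
  have hexp : Real.exp ((T + 1) * (1 + t)) ≤ 4 * w ^ 2 := by
    have h1 : 4 * w ^ 2 = Real.exp (2 * Real.log 2 * (T + 1)) := by
      rw [show 2 * Real.log 2 * (T + 1)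
        = Real.log 2 * T + Real.log 2 * T + Real.log 2 + Real.log 2 by ring,
        Real.exp_add, Real.exp_add, Real.exp_add, Real.exp_log (by norm_num), ← hwe]
      ring
    rw [h1, Real.exp_le_exp, mul_comm]
    exact mul_le_mul_of_nonneg_right (by linarith) (by linarith)
  rw [h5]
  have h1 : T * Real.exp ((T + 1) * (1 + t)) ≤ w / 2 * (4 * w ^ 2) :=
    mul_le_mul (by linarith) hexp (Real.exp_pos _).le (by linarith)
  have h2 : T * t ≤ w / 2 * (1 / 3) := mul_le_mul (by linarith) ht ht0 (by linarith)
  have h3 : w ^ 3 * 16 ≤ w ^ 5 := by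
    nlinarith [mul_nonneg (pow_nonneg (by linarith : 0 ≤ w) 3)
      (by nlinarith : (0:ℝ) ≤ w ^ 2 - 16)]
  have h4 : w ≤ w ^ 3 := le_self_pow₀ (by linarith) (by norm_num)
  linarith

theorem PermArray.factorial_mul_le_two_mul_V_mul_P (n r : ℕ) (hV : 2 ≤ V n r)
    (hx : 10 < Real.logb 2 (V n r) - 1 / 2 * Real.logb 2 (E n r)) :
    n.factorial * ((Real.logb 2 (V n r) - 1 / 2 * Real.logb 2 (E n r)) / 5)
      ≤ 2 * (V n r : ℝ) * P n (r + 1) := by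
  have hVE := V_le_six_mul_E n r
  have hD : (2 : ℝ) ≤ V n r := by exact_mod_cast hV
  set D : ℝ := (V n r : ℝ)
  set e : ℝ := E n r
  have he0 : 0 < e := by linarith
  -- If e < 1, then D ≤ 1 + 6e < 8 and e ≥ (D - 1)/6 > 1/8, so x ≤ 3 + 3/2, contrary to x > 10.
  have he1 : 1 ≤ e := by
    by_contra! hlt
    have h1 : Real.logb 2 D ≤ 3 := by
      rw [Real.logb_le_iff_le_rpow (by norm_num) (by linarith)]
      norm_num
      linarith
    have h2 : -3 ≤ Real.logb 2 e := by
      rw [Real.le_logb_iff_rpow_le (by norm_num) he0, Real.rpow_neg (by norm_num)]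
      norm_num
      linarith
    linarith
  set x := Real.logb 2 D - 1 / 2 * Real.logb 2 e with hxdef
  have hs1 : 1 ≤ √e := Real.one_le_sqrt.2 he1
  have hse : √e * √e = e := Real.mul_self_sqrt he0.le
  have hR : (2 : ℝ) ^ x = D / √e := by
    have h : x = Real.logb 2 (D / √e) := by
      rw [Real.logb_div (by positivity) (by positivity), Real.sqrt_eq_rpow,
        Real.logb_rpow_eq_mul_logb_of_pos he0]
    rw [h, Real.rpow_logb (by norm_num) (by norm_num) (by positivity)]
  have ht : 1 / (3 * √e) ≤ 1 / 3 := one_div_le_one_div_of_le (by norm_num) (by linarith)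
  have ha := mul_exp_le_two_rpow (T := x / 5) (by linarith)
    (by positivity : (0:ℝ) ≤ 1 / (3 * √e)) ht
  rw [mul_div_cancel₀ x (by norm_num), hR] at ha
  -- The fugacity t = 1/(3√e) makes 6e·t² = 2/3 ≤ 1 and a·t = D/(3√e) = 2^x/3, and a + Δ = 2D - 1 ≤
  -- 2D.
  obtain ⟨S, hS, hcard⟩ := SimpleGraph.exists_indep_of_sparse_neighborhoods
    (G := closeGraph n (r + 1)) (t := 1 / (3 * √e)) (a := D) (T := x / 5) (Δ := D - 1)
    (by positivity) (by linarith)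
    (fun v => by
      have : (((closeGraph n (r + 1)).degree v + 1 : ℕ) : ℝ) ≤ D :=
        Nat.cast_le.2 (degree_closeGraph_le r v)
      push_cast at this
      linarith)
    (fun v => by
      refine (mul_le_mul_of_nonneg_right (sum_card_common_neighbors_le r v)
        (by positivity)).trans ?_
      rw [div_pow, mul_pow, sq √e, hse, mul_div_assoc', div_le_one (by positivity)]
      change 6 * e * 1 ^ 2 ≤ 3 ^ 2 * e
      linarith)
    (ha.trans (le_of_eq (by field_simp)))
  rw [Fintype.card_perm, Fintype.card_fin] at hcard
  refine hcard.trans (mul_le_mul (by linarith) (by exact_mod_cast card_le_P hS) (by positivity)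
    (by linarith))

theorem theorem1 (n d : ℕ) (hd : 1 ≤ d) (hdn : d ≤ n) :
    (n.factorial : ℝ) / (10 * (PermArray.V n (d - 1) : ℝ)) *
        (Real.logb 2 (PermArray.V n (d - 1) : ℝ)
          - 1 / 2 * Real.logb 2 (PermArray.E n (d - 1)))
      ≤ (PermArray.P n d : ℝ) := by
  obtain ⟨r, rfl⟩ := Nat.exists_eq_add_of_le' hd
  rw [Nat.add_sub_cancel]
  rcases lt_or_ge r 2 with hr | hr
  · have hE : PermArray.E n r = 0 := by simp [PermArray.E, Finset.Icc_eq_empty_of_lt hr]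
    have hV : PermArray.V n r = 1 := by simp [PermArray.V_eq, Finset.Icc_eq_empty_of_lt hr]
    -- Both logarithms vanish, because `Real.logb 2 0 = 0`.
    simp [hE, hV]
  have hV : 2 ≤ PermArray.V n r := by
    have h2 : 2 ∈ Finset.Icc 2 r := Finset.mem_Icc.2 ⟨le_rfl, hr⟩
    have h := Finset.single_le_sum (f := fun i => n.choose i * numDerangements i)
      (fun _ _ => Nat.zero_le _) h2
    have hc : 1 ≤ n.choose 2 := Nat.choose_pos (by omega)
    have hD2 : numDerangements 2 = 1 := rfl
    rw [PermArray.V_eq]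
    simp only [hD2, mul_one] at h
    omega
  have hV0 : (0 : ℝ) < PermArray.V n r := by exact_mod_cast (by omega : 0 < PermArray.V n r)
  rw [div_mul_eq_mul_div, div_le_iff₀ (by positivity)]
  -- Up to 10 the greedy bound suffices, thanks to the factor 10 in the denominator; above 10, T =
  -- x/5 exceeds 2, as `mul_exp_le_two_rpow` requires.
  rcases le_or_gt (Real.logb 2 (PermArray.V n r) - 1 / 2 * Real.logb 2 (PermArray.E n r)) 10
    with hx | hx
  · have h1 : (n.factorial : ℝ) ≤ PermArray.P n (r + 1) * PermArray.V n r := by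
      exact_mod_cast PermArray.factorial_le_P_mul_V n r
    have := mul_le_mul_of_nonneg_left hx (Nat.cast_nonneg (α := ℝ) n.factorial)
    linarith
  · have := PermArray.factorial_mul_le_two_mul_V_mul_P n r hV hx
    linarith
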